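/- Let $n\ge 1$, let $\vec A_n$ be the quiver $1\to 2\to\cdots\to n$ (with $\vec A_0$ the empty quiver), and let $\mathcal A$ be an abelian category. Write $[\vec A_n,\mathcal A]$ for the category of representations of $\vec A_n$ in $\mathcal A$, and $[\vec A_n,\operatorname{Proj}\mathcal A]$, $[\vec A_n,\operatorname{Inj}\mathcal A]$ for its full subcategories of representations with projective, respectively injective, objects at every vertex. For a vertex $i$ let $\mathsf I_i,\mathsf P_i\colon\mathcal A\to[\vec A_n,\mathcal A]$ be the right, respectively left, adjoint of evaluation at $i$; so $\mathsf I_i(M)_j$ (respectively $\mathsf P_i(M)_j$) is the direct sum of copies of $M$ indexed by the paths from $j$ to $i$ (respectively from $i$ to $j$). For a class $\mathcal S$ of objects, $\operatorname{add}\mathcal S$ is the smallest class containing $\mathcal S$ and closed under finite direct sums and direct summands. For a full subcategory $\mathcal X$, closed under finite direct sums, of an additive category $\mathcal E$, the additive quotient $\mathcal E/\mathcal X$ has the objects of $\mathcal E$, and its morphisms are those of $\mathcal E$ modulo the relation $f\sim g$ if and only if $f-g$ factors through an object of $\mathcal X$. (a) Suppose that $\mathcal A$ has enough projectives, and let $\mathbb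 T=\operatorname{add}\{\mathsf I_i(P)\mid 1\le i\le n,\ P\in\operatorname{Proj}\mathcal A\}$. Then there is an equivalence of additive categories $$\frac{[\vec A_n,\operatorname{Proj}\mathcal A]}{\mathbb T}\simeq[\vec A_{n-1},\mathcal A],$$ and $\mathbb T$ consists exactly of the representations with projective objects at every vertex all of whose structure maps are epimorphisms. (b) Suppose that $\mathcal A$ has enough injectives, and let $\mathbb C=\operatorname{add}\{\mathsf P_i(I)\mid 1\le i\le n,\ I\in\operatorname{Inj}\mathcal A\}$. Then there is an equivalence of additive categories $$\frac{[\vec A_n,\operatorname{Inj}\mathcal A]}{\mathbb C}\simeq[\vec A_{n-1},\mathcal A],$$ and $\mathbb C$ consists exactly of the representations with injective objects at every vertex all of whose structure maps are monomorphisms. -/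

import Mathlib

open CategoryTheory CategoryTheory.Limits

universe v u

namespace AnRep

noncomputable section

section AdditiveQuotient

variable {E : Type u} [Category.{v} E] [Preadditive E]

/-- `f ∼ g` if and only if `f - g` factors through an object of `X`. -/
def additiveRel (X : ObjectProperty E) : HomRel E := fun M N f g =>
  ∃ (Z : E) (_ : X Z) (a : M ⟶ Z) (b : Z ⟶ N), f - g = a ≫ b

lemma additiveRel_add [HasFiniteProducts E] (X : ObjectProperty E)
    [X.IsClosedUnderFiniteProducts] {M N : E} {f₁ f₂ g₁ g₂ : M ⟶ N}
    (hf : additiveRel X f₁ f₂) (hg : additiveRel X g₁ g₂) :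
    additiveRel X (f₁ + g₁) (f₂ + g₂) := by
  obtain ⟨Z, hZ, a, b, h⟩ := hf
  obtain ⟨W, hW, c, d, k⟩ := hg
  have : HasBinaryBiproducts E := HasBinaryBiproducts.of_hasBinaryProducts
  refine ⟨Z ⊞ W, X.prop_of_isLimit_binaryFan (BinaryBiproduct.isLimit Z W) hZ hW,
    biprod.lift a c, biprod.desc b d, ?_⟩
  rw [biprod.lift_desc, ← h, ← k]
  abel

/-- When `X` is closed under finite direct sums, the relation `∼` is a congruence, so that
the morphisms of the quotient category below are exactly the classes for `∼`. -/
instance additiveRel_congruence [HasFiniteProducts E] (X : ObjectProperty E)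
    [X.IsClosedUnderFiniteProducts] : Congruence (additiveRel X) where
  comp_left := by
    rintro M N L f g g' ⟨Z, hZ, a, b, h⟩
    exact ⟨Z, hZ, f ≫ a, b, by rw [← Preadditive.comp_sub, h, Category.assoc]⟩
  comp_right := by
    rintro M N L f f' g ⟨Z, hZ, a, b, h⟩
    exact ⟨Z, hZ, a, b ≫ g, by rw [← Preadditive.sub_comp, h, Category.assoc]⟩
  equivalence :=
    { refl := fun f => ⟨⊤_ E, X.prop_terminal, terminal.from _, 0, by simp⟩
      symm := by
        rintro f g ⟨Z, hZ, a, b, h⟩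
        exact ⟨Z, hZ, -a, b, by rw [Preadditive.neg_comp, ← h, neg_sub]⟩
      trans := by
        intro f g h hfg hgh
        obtain ⟨Z, hZ, a, b, e⟩ := additiveRel_add X hfg hgh
        exact ⟨Z, hZ, a, b, by rw [← e]; abel⟩ }

/-- The additive quotient `E / X`: the objects are those of `E`, and
`Hom_{E/X}(M, N) = Hom_E(M, N) / ∼`. -/
abbrev AdditiveQuotient (X : ObjectProperty E) := Quotient (additiveRel X)

/-- The addition on `Hom_{E/X}(M, N)` is the one induced by `Hom_E(M, N)`. -/
instance [HasFiniteProducts E] (X : ObjectProperty E) [X.IsClosedUnderFiniteProducts] :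
    Preadditive (AdditiveQuotient X) :=
  Quotient.preadditive _ fun _ _ _ _ _ _ hf hg => additiveRel_add X hf hg

/-- `add S`: the smallest class of objects that contains `S` and is closed under finite direct
sums and direct summands. (In an abelian category the direct summands of `M` are its retracts.) -/
inductive addClosure [HasBinaryBiproducts E] (S : ObjectProperty E) : ObjectProperty E
  | of (M : E) : S M → addClosure S M
  | zero (M : E) : IsZero M → addClosure S M
  | biprod (M N : E) : addClosure S M → addClosure S N → addClosure S (M ⊞ N)
  | summand (M N : E) : Retract N M → addClosure S M → addClosure S N

end AdditiveQuotient

section ClosedUnderSums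

variable {C : Type u} [Category.{v} C] [Abelian C]

lemma closedUnderFiniteProducts_of_biprod (P : ObjectProperty C)
    (hiso : ∀ M N : C, (M ≅ N) → P M → P N) (hzero : ∀ M : C, IsZero M → P M)
    (hbiprod : ∀ M N : C, P M → P N → P (M ⊞ N)) : P.IsClosedUnderFiniteProducts := by
  have : P.IsClosedUnderIsomorphisms := ⟨fun {M N} e h => hiso M N e h⟩
  have : P.ContainsZero := 
    let ⟨Z, hZ⟩ := HasZeroObject.zero (C := C)
    ⟨⟨Z, hZ, hzero Z hZ⟩⟩
  have : P.IsClosedUnderBinaryProducts := ⟨by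
    rintro M ⟨p⟩
    have hp := p.prop_diag_obj
    let e : p.diag ≅ pair (p.diag.obj ⟨.left⟩) (p.diag.obj ⟨.right⟩) := diagramIsoPair _
    let i : ((p.diag.obj ⟨.left⟩) ⊞ (p.diag.obj ⟨.right⟩)) ≅ M :=
      IsLimit.conePointsIsoOfNatIso (BinaryBiproduct.isLimit _ _) p.isLimit e.symm
    exact hiso _ _ i (hbiprod _ _ (hp _) (hp _))⟩
  exact ObjectProperty.IsClosedUnderFiniteProducts.mk'

instance (S : ObjectProperty C) : (addClosure S).IsClosedUnderFiniteProducts :=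
  closedUnderFiniteProducts_of_biprod _ (fun M N e h => .summand M N (Retract.ofIso e.symm) h)
    (fun M h => .zero M h) (fun M N h k => .biprod M N h k)

end ClosedUnderSums

section Representations

/-- The category `[A_n, C]` of representations in `C` of the quiver `A_n : 1 → 2 → ⋯ → n`, with
vertices indexed by `Fin n`. The free category on `A_n` is the ordered set `Fin n`: there is exactly
one path from `i` to `j` if `i ≤ j` and none otherwise. -/
abbrev Rep (n : ℕ) (C : Type u) [Category.{v} C] := Fin n ⥤ C


/-- The representations all of whose entries lie in `P`, i.e. `[A_n, P] ⊆ [A_n, C]`. -/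
def entriesIn (n : ℕ) {C : Type u} [Category.{v} C] (P : ObjectProperty C) : ObjectProperty (Rep n C) :=
  fun X => ∀ i, P (X.obj i)

/-- The representations all of whose structure maps are epimorphisms. -/
def epimorphic (n : ℕ) (C : Type u) [Category.{v} C] : ObjectProperty (Rep n C) :=
  fun X => ∀ ⦃i j : Fin n⦄ (α : i ⟶ j), Epi (X.map α)

/-- The representations all of whose structure maps are monomorphisms. -/
def monomorphic (n : ℕ) (C : Type u) [Category.{v} C] : ObjectProperty (Rep n C) :=
  fun X => ∀ ⦃i j : Fin n⦄ (α : i ⟶ j), Mono (X.map α)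

variable (n : ℕ) (C : Type u) [Category.{v} C] [Abelian C]

/-- `I_i : C ⥤ [A_n, C]`, the right adjoint of evaluation at the vertex `i`: its value at the
vertex `j` is the sum of copies of the given object over the paths from `j` to `i`. -/
abbrev rightAdjEval (i : Fin n) : C ⥤ Rep n C := evaluationRightAdjoint C i

/-- `P_i : C ⥤ [A_n, C]`, the left adjoint of evaluation at the vertex `i`: its value at the
vertex `j` is the sum of copies of the given object over the paths from `i` to `j`. -/
abbrev leftAdjEval (i : Fin n) : C ⥤ Rep n C := evaluationLeftAdjoint C i

/-- `[A_n, Proj C]`, as a full subcategory of `[A_n, C]`. -/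
abbrev projReps : ObjectProperty (Rep n C) := entriesIn n (isProjective C)

/-- `[A_n, Inj C]`, as a full subcategory of `[A_n, C]`. -/
abbrev injReps : ObjectProperty (Rep n C) := entriesIn n (isInjective C)

/-- `𝕋 = add {I_i(Q) | i a vertex, Q projective}`. -/
def tiltingSubcategory : ObjectProperty (Rep n C) :=
  addClosure fun X => ∃ (i : Fin n) (Q : C), Projective Q ∧ X = (rightAdjEval n C i).obj Q

/-- `ℂ = add {P_i(J) | i a vertex, J injective}`. -/
def cotiltingSubcategory : ObjectProperty (Rep n C) :=
  addClosure fun X => ∃ (i : Fin n) (J : C), Injective J ∧ X = (leftAdjEval n C i).obj J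

instance : (tiltingSubcategory n C).IsClosedUnderFiniteProducts := by
  unfold tiltingSubcategory; infer_instance

instance : (cotiltingSubcategory n C).IsClosedUnderFiniteProducts := by
  unfold cotiltingSubcategory; infer_instance

lemma entriesIn_closed (R : ObjectProperty C)
    (hiso : ∀ M N : C, (M ≅ N) → R M → R N) (hzero : ∀ M : C, IsZero M → R M)
    (hbiprod : ∀ M N : C, R M → R N → R (M ⊞ N)) :
    (entriesIn n R).IsClosedUnderFiniteProducts :=
  closedUnderFiniteProducts_of_biprod _
    (fun _ _ e h i => hiso _ _ (e.app i) (h i))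
    (fun _ h i => hzero _ (((evaluation (Fin n) C).obj i).map_isZero h))
    (fun M N h k i =>
      have := preservesBinaryBiproducts_of_preservesBinaryProducts ((evaluation (Fin n) C).obj i)
      hiso _ _ (((evaluation (Fin n) C).obj i).mapBiprod M N).symm
      (hbiprod _ _ (h i) (k i)))

instance : (projReps n C).IsClosedUnderFiniteProducts :=
  entriesIn_closed n C _ (fun _ _ e h => Projective.of_iso e h)
    (fun _ h => Projective.of_iso h.isoZero.symm inferInstance)
    (fun _ _ (_ : Projective _) (_ : Projective _) => (inferInstance : Projective _))

instance : (injReps n C).IsClosedUnderFiniteProducts :=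
  entriesIn_closed n C _ (fun _ _ e h => Injective.of_iso e h)
    (fun _ h => Injective.of_iso h.isoZero.symm inferInstance)
    (fun _ _ (_ : Injective _) (_ : Injective _) => (inferInstance : Injective _))

/-- `𝕋`, as a class of objects of `[A_n, Proj C]`. -/
abbrev tiltingInProj : ObjectProperty (projReps n C).FullSubcategory :=
  (tiltingSubcategory n C).inverseImage (projReps n C).ι

/-- `ℂ`, as a class of objects of `[A_n, Inj C]`. -/
abbrev cotiltingInInj : ObjectProperty (injReps n C).FullSubcategory :=
  (cotiltingSubcategory n C).inverseImage (injReps n C).ι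

lemma inverseImage_closed {D : Type u} [Category.{v} D] [HasFiniteProducts D]
    (Q R : ObjectProperty D) [Q.IsClosedUnderFiniteProducts] [R.IsClosedUnderFiniteProducts] :
    (Q.inverseImage R.ι).IsClosedUnderFiniteProducts where
  isClosedUnderLimitsOfShape J _ :=
    have : PreservesLimitsOfShape (Discrete J) R.ι :=
      preservesLimitOfShape_of_createsLimitsOfShape_and_hasLimitsOfShape R.ι
    inferInstance

instance : (tiltingInProj n C).IsClosedUnderFiniteProducts := inverseImage_closed _ _

instance : (cotiltingInInj n C).IsClosedUnderFiniteProducts := inverseImage_closed _ _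

end Representations

end

end AnRep

/-! Write n = m + 1 and number the vertices 0, …, m. The equivalence in (a) is induced by
`cokernelFunctor`, P ↦ (coker(P_0 → P_1) → ⋯ → coker(P_0 → P_m)). By `additiveQuotient_equivalence`
it is enough that, on representations with projective entries, this functor is full, dense, and
kills exactly the maps that factor through 𝕋.

All three rest on trivial fibrations p : X ⟶ Y, for which every X_i → Y_i and every X_i → Y_i
×_{Y_j} X_j is epi. Representations with projective entries lift along them
(`IsTrivialFibration.exists_lift`), and every Y receives one from such a representation
(`exists_isTrivialFibration`). Fullness: the map from Q to the extension by zero of its cokernel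
representation is a trivial fibration. Density: resolve the extension of Y by zero. Kernel: a killed
map P ⟶ Q lands in the image S of the constant representation on Q_0, hence lifts to a resolution T
of S; as S is epimorphic, so is T.

For the description of 𝕋, let X be epimorphic with projective entries and zero after i. The
epimorphism X_0 → X_i splits, which makes I_i(X_i) a summand of X with a complement that vanishes
from i on; induct.

The equivalence in (b) is the construction for (a) applied to the opposite category with the
vertices reversed. The description of ℂ is proved by the mirrored splitting argument, so
`addClosure` need not be carried through the duality. -/

namespace AnRep

/-! ### Additive quotients and full dense functors. -/

section QuotientEquivalence

variable {E : Type*} [Category* E] [Preadditive E] [HasFiniteProducts E]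
  {D : Type*} [Category* D] [Preadditive D]

/-- A full, essentially surjective additive functor which kills exactly the morphisms factoring
through `X` induces an equivalence from the additive quotient by `X`. -/
theorem additiveQuotient_equivalence (X : ObjectProperty E) [X.IsClosedUnderFiniteProducts]
    (F : E ⥤ D) [F.Additive] [F.Full] [F.EssSurj]
    (hF : ∀ ⦃M N : E⦄ (f : M ⟶ N), F.map f = 0 ↔
      ∃ (Z : E) (_ : X Z) (a : M ⟶ Z) (b : Z ⟶ N), f = a ≫ b) :
    ∃ e : AdditiveQuotient X ≌ D, e.functor.Additive := by
  have H : ∀ (M N : E) (f g : M ⟶ N), additiveRel X f g ↔ F.map f = F.map g := fun M N f g => by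
    rw [← sub_eq_zero, ← F.map_sub, hF]
    rfl
  let G : AdditiveQuotient X ⥤ D := CategoryTheory.Quotient.lift _ F fun M N f g h => (H M N f g).1 h
  have hG : ∀ {M N : E} (f : M ⟶ N), G.map ((Quotient.functor (additiveRel X)).map f) = F.map f :=
    fun f => CategoryTheory.Quotient.lift_map_functor_map _ _ _ f
  have : G.Full := ⟨fun {M N} φ =>
    ⟨(Quotient.functor _).map (F.preimage φ), (hG _).trans (F.map_preimage φ)⟩⟩
  have : G.Faithful := ⟨fun {M N} f g h => by
    obtain ⟨f, rfl⟩ := (Quotient.functor (additiveRel X)).map_surjective f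
    obtain ⟨g, rfl⟩ := (Quotient.functor (additiveRel X)).map_surjective g
    exact CategoryTheory.Quotient.sound _ ((H _ _ f g).2 ((hG f).symm.trans (h.trans (hG g))))⟩
  have : G.EssSurj := ⟨fun d => ⟨(Quotient.functor _).obj (F.objPreimage d),
    ⟨F.objObjPreimageIso d⟩⟩⟩
  have : G.IsEquivalence := {}
  refine ⟨G.asEquivalence, ⟨fun {M N} f g => ?_⟩⟩
  obtain ⟨f, rfl⟩ := (Quotient.functor (additiveRel X)).map_surjective f
  obtain ⟨g, rfl⟩ := (Quotient.functor (additiveRel X)).map_surjective g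
  exact (hG (f + g)).trans ((F.map_add).trans (congrArg₂ (· + ·) (hG f).symm (hG g).symm))

end QuotientEquivalence

section FullSubcategoryQuotient

variable {E : Type u} [Category.{v} E] [Preadditive E] [HasFiniteProducts E]
  {D : Type*} [Category* D] [Preadditive D]

/-- The version of `additiveQuotient_equivalence` for a full subcategory `R` of the source. -/
theorem fullSubcategory_quotient_equivalence (T R : ObjectProperty E)
    [R.IsClosedUnderFiniteProducts]
    [(T.inverseImage R.ι).IsClosedUnderFiniteProducts] (F : E ⥤ D) [F.Additive]
    (full : ∀ ⦃M N : E⦄, R M → R N → ∀ φ : F.obj M ⟶ F.obj N, ∃ f : M ⟶ N, F.map f = φ)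
    (dense : ∀ d : D, ∃ M : E, R M ∧ Nonempty (F.obj M ≅ d))
    (zero : ∀ Z : E, T Z → IsZero (F.obj Z))
    (ker : ∀ ⦃M N : E⦄, R M → R N → ∀ f : M ⟶ N, F.map f = 0 →
      ∃ (Z : E) (_ : R Z) (_ : T Z) (a : M ⟶ Z) (b : Z ⟶ N), f = a ≫ b) :
    ∃ e : AdditiveQuotient (T.inverseImage R.ι) ≌ D, e.functor.Additive := by
  have : (R.ι ⋙ F).Additive := ⟨fun {_ _ f g} => F.map_add (f := f.hom) (g := g.hom)⟩
  have : (R.ι ⋙ F).Full := ⟨fun {M N} φ => by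
    obtain ⟨f, hf⟩ := full M.2 N.2 φ
    exact ⟨ObjectProperty.homMk f, hf⟩⟩
  have : (R.ι ⋙ F).EssSurj := ⟨fun d => by
    obtain ⟨M, hM, e⟩ := dense d
    exact ⟨⟨M, hM⟩, e⟩⟩
  refine additiveQuotient_equivalence _ (R.ι ⋙ F) fun M N f => ⟨fun h => ?_, ?_⟩
  · obtain ⟨Z, hZ, hZ', a, b, e⟩ := ker M.2 N.2 f.hom h
    exact ⟨⟨Z, hZ⟩, hZ', ObjectProperty.homMk a, ObjectProperty.homMk b,
      ObjectProperty.hom_ext _ e⟩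
  · rintro ⟨Z, hZ, a, b, rfl⟩
    rw [Functor.map_comp, (zero _ hZ).eq_zero_of_tgt ((R.ι ⋙ F).map a), zero_comp]

end FullSubcategoryQuotient

/-! ### Splitting off a retract. -/

section Splitting

variable {C : Type u} [Category.{v} C] [Abelian C]

/-- The kernel of a split epimorphism is a retract of the source. -/
noncomputable def kernelRetract {M X : C} (s : M ⟶ X) (r : X ⟶ M) (h : s ≫ r = 𝟙 M) :
    Retract (kernel r) X where
  i := kernel.ι r
  r := kernel.lift r (𝟙 X - r ≫ s) (by simp [h])
  retract := by
    rw [← cancel_mono (kernel.ι r)]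
    simp

/-- A retract of `X` and the complementary kernel generate `X`. -/
lemma addClosure_of_splitting {S : ObjectProperty C} {M X : C} (s : M ⟶ X) (r : X ⟶ M)
    (h : s ≫ r = 𝟙 M) (hM : addClosure S M) (hK : addClosure S (kernel r)) : addClosure S X :=
  .summand _ _
    { i := biprod.lift r (kernel.lift r (𝟙 X - r ≫ s) (by simp [h]))
      r := biprod.desc s (kernel.ι r)
      retract := by simp }
    (.biprod _ _ hM hK)

end Splitting

/-! ### Objects of 𝕋 are epimorphic with projective entries, and dually for ℂ. -/

section Closure

variable (n : ℕ) {C : Type u} [Category.{v} C] [Abelian C]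

lemma epimorphic_of_retract {X Y : Rep n C} (r : Retract Y X) (h : epimorphic n C X) :
    epimorphic n C Y := fun i j α => by
  have := h α
  have e : X.map α ≫ r.r.app j = r.r.app i ≫ Y.map α := r.r.naturality α
  have : IsSplitEpi (r.r.app j) := ⟨⟨r.i.app j, by simp [← NatTrans.comp_app]⟩⟩
  have : Epi (r.r.app i ≫ Y.map α) := e ▸ inferInstance
  exact epi_of_epi (r.r.app i) _

lemma monomorphic_of_retract {X Y : Rep n C} (r : Retract Y X) (h : monomorphic n C X) :
    monomorphic n C Y := fun i j α => by
  have := h α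
  have e : Y.map α ≫ r.i.app j = r.i.app i ≫ X.map α := r.i.naturality α
  have : IsSplitMono (r.i.app i) := ⟨⟨r.r.app i, by simp [← NatTrans.comp_app]⟩⟩
  have : Mono (Y.map α ≫ r.i.app j) := e ▸ inferInstance
  exact mono_of_mono _ (r.i.app j)

/-- The retract at a vertex induced by a retract of representations. -/
def retractApp {X Y : Rep n C} (r : Retract Y X) (i : Fin n) : Retract (Y.obj i) (X.obj i) :=
  r.map ((evaluation (Fin n) C).obj i)

lemma epimorphic_biprod {X Y : Rep n C} (hX : epimorphic n C X) (hY : epimorphic n C Y) :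
    epimorphic n C (X ⊞ Y) := fun i j α => by
  have := hX α
  have := hY α
  refine Preadditive.epi_of_cancel_zero _ fun {Z} g hg => ?_
  have h₁ : (biprod.inl : X ⟶ X ⊞ Y).app j ≫ g = 0 := by
    rw [← cancel_epi (X.map α), NatTrans.naturality_assoc, hg]; simp
  have h₂ : (biprod.inr : Y ⟶ X ⊞ Y).app j ≫ g = 0 := by
    rw [← cancel_epi (Y.map α), NatTrans.naturality_assoc, hg]; simp
  -- Evaluating the biproduct identity at j shows that the two inclusions are jointly epi there.
  have e := congrArg (fun t : X ⊞ Y ⟶ X ⊞ Y => t.app j) (biprod.total (X := X) (Y := Y))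
  simp only [NatTrans.app_add, NatTrans.comp_app, NatTrans.id_app] at e
  rw [← Category.id_comp g, ← e, Preadditive.add_comp]
  simp [h₁, h₂]

lemma monomorphic_biprod {X Y : Rep n C} (hX : monomorphic n C X) (hY : monomorphic n C Y) :
    monomorphic n C (X ⊞ Y) := fun i j α => by
  have := hX α
  have := hY α
  refine Preadditive.mono_of_cancel_zero _ fun {Z} g hg => ?_
  have h₁ : g ≫ (biprod.fst : X ⊞ Y ⟶ X).app i = 0 := by
    rw [← cancel_mono (X.map α), Category.assoc, ← NatTrans.naturality, reassoc_of% hg]; simp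
  have h₂ : g ≫ (biprod.snd : X ⊞ Y ⟶ Y).app i = 0 := by
    rw [← cancel_mono (Y.map α), Category.assoc, ← NatTrans.naturality, reassoc_of% hg]; simp
  have e := congrArg (fun t : X ⊞ Y ⟶ X ⊞ Y => t.app i) (biprod.total (X := X) (Y := Y))
  simp only [NatTrans.app_add, NatTrans.comp_app, NatTrans.id_app] at e
  rw [← Category.comp_id g, ← e, Preadditive.comp_add]
  simp [reassoc_of% h₁, reassoc_of% h₂]

lemma entriesIn_biprod {R : ObjectProperty C} [(entriesIn n R).IsClosedUnderFiniteProducts]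
    {X Y : Rep n C} (hX : entriesIn n R X) (hY : entriesIn n R Y) : entriesIn n R (X ⊞ Y) :=
  (entriesIn n R).prop_of_isLimit_binaryFan (BinaryBiproduct.isLimit X Y) hX hY

lemma isZero_obj {X : Rep n C} (h : IsZero X) (i : Fin n) : IsZero (X.obj i) :=
  ((evaluation (Fin n) C).obj i).map_isZero h

/-- There is at most one path between two vertices, so I_i(Q) is Q up to the vertex i and zero after
it: a structure map is a split epimorphism or has zero target. -/
lemma epimorphic_rightAdjEval (i : Fin n) (Q : C) :
    epimorphic n C ((rightAdjEval n C i).obj Q) := fun j k α => by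
  refine Preadditive.epi_of_cancel_zero _ fun {Z} g hg => ?_
  by_cases h : k ≤ i
  · have : IsSplitEpi (((rightAdjEval n C i).obj Q).map α) :=
      ⟨⟨Pi.lift fun _ => Pi.π (fun _ : k ⟶ i => Q) (homOfLE h), by
        apply Pi.hom_ext
        intro b
        obtain rfl := Subsingleton.elim b (homOfLE h)
        change ((Pi.lift fun _ : j ⟶ i => Pi.π (fun _ : k ⟶ i => Q) (homOfLE _)) ≫
          Pi.lift fun g : k ⟶ i => Pi.π (fun _ : j ⟶ i => Q) (α ≫ g)) ≫ Pi.π _ _ =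
            𝟙 (∏ᶜ fun _ : k ⟶ i => Q) ≫ Pi.π _ _
        simp only [Category.assoc, limit.lift_π, Fan.mk_pt, Fan.mk_π_app, Category.id_comp]⟩⟩
    rwa [← cancel_epi (((rightAdjEval n C i).obj Q).map α), comp_zero]
  · have : IsZero (((rightAdjEval n C i).obj Q).obj k) := by
      rw [IsZero.iff_id_eq_zero]
      apply Pi.hom_ext
      intro b
      exact (h (leOfHom b)).elim
    exact this.eq_zero_of_src g

lemma monomorphic_leftAdjEval (i : Fin n) (Q : C) :
    monomorphic n C ((leftAdjEval n C i).obj Q) := fun j k α => by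
  refine Preadditive.mono_of_cancel_zero _ fun {Z} g hg => ?_
  by_cases h : i ≤ j
  · have : IsSplitMono (((leftAdjEval n C i).obj Q).map α) :=
      ⟨⟨Limits.Sigma.desc fun _ => Sigma.ι (fun _ : i ⟶ j => Q) (homOfLE h), by
        apply Sigma.hom_ext
        intro b
        obtain rfl := Subsingleton.elim b (homOfLE h)
        change Sigma.ι (fun _ : i ⟶ j => Q) _ ≫
          (Limits.Sigma.desc fun g : i ⟶ j => Sigma.ι (fun _ : i ⟶ k => Q) (g ≫ α)) ≫
          (Limits.Sigma.desc fun _ => Sigma.ι (fun _ : i ⟶ j => Q) _) =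
            Sigma.ι _ _ ≫ 𝟙 (∐ fun _ : i ⟶ j => Q)
        simp only [colimit.ι_desc, colimit.ι_desc_assoc, Cofan.mk_pt, Cofan.mk_ι_app,
          Category.comp_id]⟩⟩
    rwa [← cancel_mono (((leftAdjEval n C i).obj Q).map α), zero_comp]
  · have : IsZero (((leftAdjEval n C i).obj Q).obj j) := by
      rw [IsZero.iff_id_eq_zero]
      apply Sigma.hom_ext
      intro b
      exact (h (leOfHom b)).elim
    exact this.eq_zero_of_tgt g

/-- Each entry is a product of at most one copy of Q, hence a retract of Q even when the product is
empty. -/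
lemma projReps_rightAdjEval (i : Fin n) (Q : C) [Projective Q] :
    projReps n C ((rightAdjEval n C i).obj Q) := fun j => by
  by_cases h : j ≤ i
  · exact Retract.projective (Y := Q)
      { i := Pi.π _ (homOfLE h)
        r := Pi.lift fun _ => 𝟙 Q
        retract := by
          apply Pi.hom_ext
          intro b
          obtain rfl := Subsingleton.elim b (homOfLE h)
          change (Pi.π (fun _ : j ⟶ i => Q) _ ≫ Pi.lift fun _ => 𝟙 Q) ≫ Pi.π _ _ =
            𝟙 (∏ᶜ fun _ : j ⟶ i => Q) ≫ Pi.π _ _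
          simp only [Category.assoc, limit.lift_π, Fan.mk_pt, Fan.mk_π_app, Category.id_comp,
            Category.comp_id] }
  · exact Retract.projective (Y := Q)
      { i := 0
        r := 0
        retract := by
          apply Pi.hom_ext
          intro b
          exact (h (leOfHom b)).elim }

lemma injReps_leftAdjEval (i : Fin n) (Q : C) [Injective Q] :
    injReps n C ((leftAdjEval n C i).obj Q) := fun j => by
  by_cases h : i ≤ j
  · exact Retract.injective (Y := Q)
      { i := Limits.Sigma.desc fun _ => 𝟙 Q
        r := Sigma.ι (fun _ : i ⟶ j => Q) (homOfLE h)
        retract := by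
          apply Sigma.hom_ext
          intro b
          obtain rfl := Subsingleton.elim b (homOfLE h)
          change Sigma.ι (fun _ : i ⟶ j => Q) _ ≫ (Limits.Sigma.desc fun _ => 𝟙 Q) ≫
            Sigma.ι (fun _ : i ⟶ j => Q) _ =
            Sigma.ι _ _ ≫ 𝟙 (∐ fun _ : i ⟶ j => Q)
          simp only [colimit.ι_desc_assoc, Cofan.mk_pt, Cofan.mk_ι_app, Category.comp_id]
          exact Category.id_comp _ }
  · exact Retract.injective (Y := Q)
      { i := 0
        r := 0
        retract := by
          apply Sigma.hom_ext
          intro b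
          exact (h (leOfHom b)).elim }

/-- Both conditions hold for the generators and survive each operation that builds `addClosure`. -/
lemma tiltingSubcategory_le :
    tiltingSubcategory n C ≤ epimorphic n C ⊓ projReps n C := fun X hX => by
  induction hX with
  | of M h =>
    obtain ⟨i, Q, hQ, rfl⟩ := h
    exact ⟨epimorphic_rightAdjEval n i Q, projReps_rightAdjEval n i Q⟩
  | zero M h =>
    exact ⟨fun i j α => ⟨fun _ _ _ => (isZero_obj n h j).eq_of_src _ _⟩,
      fun i => Projective.of_iso (isZero_obj n h i).isoZero.symm inferInstance⟩
  | biprod M N _ _ hM hN =>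
    exact ⟨epimorphic_biprod n hM.1 hN.1, entriesIn_biprod n hM.2 hN.2⟩
  | summand M N r _ hM =>
    exact ⟨epimorphic_of_retract n r hM.1, fun i =>
      have : Projective (M.obj i) := hM.2 i
      (retractApp n r i).projective⟩

lemma cotiltingSubcategory_le :
    cotiltingSubcategory n C ≤ monomorphic n C ⊓ injReps n C := fun X hX => by
  induction hX with
  | of M h =>
    obtain ⟨i, Q, hQ, rfl⟩ := h
    exact ⟨monomorphic_leftAdjEval n i Q, injReps_leftAdjEval n i Q⟩
  | zero M h =>
    exact ⟨fun i j α => ⟨fun _ _ _ => (isZero_obj n h i).eq_of_tgt _ _⟩,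
      fun i => Injective.of_iso (isZero_obj n h i).isoZero.symm inferInstance⟩
  | biprod M N _ _ hM hN =>
    exact ⟨monomorphic_biprod n hM.1 hN.1, entriesIn_biprod n hM.2 hN.2⟩
  | summand M N r _ hM =>
    exact ⟨monomorphic_of_retract n r hM.1, fun i =>
      have : Injective (M.obj i) := hM.2 i
      (retractApp n r i).injective⟩

end Closure

end AnRep

namespace AnRep

/-! ### Epimorphic representations with projective entries lie in 𝕋, and dually for ℂ. -/

section Generation

variable {m : ℕ} {C : Type u} [Category.{v} C] [Abelian C]

/-- The projection `I_i(M)_j ⟶ M` given by a path from `j` to `i`. -/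
noncomputable def rightProj (M : C) {i j : Fin (m + 1)} (g : j ⟶ i) :
    ((rightAdjEval (m + 1) C i).obj M).obj j ⟶ M :=
  Pi.π (fun _ : j ⟶ i => M) g

/-- The inclusion `M ⟶ P_i(M)_j` given by a path from `i` to `j`. -/
noncomputable def leftIncl (M : C) {i j : Fin (m + 1)} (g : i ⟶ j) :
    M ⟶ ((leftAdjEval (m + 1) C i).obj M).obj j :=
  Sigma.ι (fun _ : i ⟶ j => M) g

lemma rightAdjEval_hom_ext {M Z : C} {i j : Fin (m + 1)}
    {f g : Z ⟶ ((rightAdjEval (m + 1) C i).obj M).obj j}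
    (h : ∀ t : j ⟶ i, f ≫ rightProj M t = g ≫ rightProj M t) : f = g :=
  Pi.hom_ext _ _ h

lemma leftAdjEval_hom_ext {M Z : C} {i j : Fin (m + 1)}
    {f g : ((leftAdjEval (m + 1) C i).obj M).obj j ⟶ Z}
    (h : ∀ t : i ⟶ j, leftIncl M t ≫ f = leftIncl M t ≫ g) : f = g :=
  Sigma.hom_ext _ _ h

lemma map_rightProj (M : C) {i j k : Fin (m + 1)} (α : j ⟶ k) (t : k ⟶ i) :
    ((rightAdjEval (m + 1) C i).obj M).map α ≫ rightProj M t = rightProj M (α ≫ t) :=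
  limit.lift_π _ _

lemma leftIncl_map (M : C) {i j k : Fin (m + 1)} (α : j ⟶ k) (t : i ⟶ j) :
    leftIncl M t ≫ ((leftAdjEval (m + 1) C i).obj M).map α = leftIncl M (t ≫ α) :=
  colimit.ι_desc _ _

/-- The map `X ⟶ I_i(X_i)` adjoint to the identity. -/
noncomputable def toRightAdjEval (X : Rep (m + 1) C) (i : Fin (m + 1)) :
    X ⟶ (rightAdjEval (m + 1) C i).obj (X.obj i) :=
  (evaluationAdjunctionLeft C i).unit.app X

/-- The map `P_i(X_i) ⟶ X` adjoint to the identity. -/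
noncomputable def ofLeftAdjEval (X : Rep (m + 1) C) (i : Fin (m + 1)) :
    (leftAdjEval (m + 1) C i).obj (X.obj i) ⟶ X :=
  (evaluationAdjunctionRight C i).counit.app X

lemma toRightAdjEval_app_rightProj (X : Rep (m + 1) C) {i j : Fin (m + 1)} (g : j ⟶ i) :
    (toRightAdjEval X i).app j ≫ rightProj _ g = X.map g := by
  have e : (toRightAdjEval X i).app j = Pi.lift fun g : j ⟶ i => X.map g := by
    simp only [toRightAdjEval, evaluationAdjunctionLeft_unit_app_app]
    rfl
  exact (congrArg (· ≫ rightProj _ g) e).trans (limit.lift_π (Fan.mk _ fun g : j ⟶ i => X.map g) ⟨g⟩)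

lemma leftIncl_ofLeftAdjEval_app (X : Rep (m + 1) C) {i j : Fin (m + 1)} (g : i ⟶ j) :
    leftIncl _ g ≫ (ofLeftAdjEval X i).app j = X.map g := by
  have e : (ofLeftAdjEval X i).app j = Limits.Sigma.desc fun g : i ⟶ j => X.map g := by
    simp only [ofLeftAdjEval, evaluationAdjunctionRight_counit_app_app]
    rfl
  exact (congrArg (leftIncl _ g ≫ ·) e).trans (colimit.ι_desc (Cofan.mk _ fun g : i ⟶ j => X.map g) ⟨g⟩)

/-- The map `I_i(M) ⟶ X` given by a map `M ⟶ X_0`, when `X` vanishes after `i`. -/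
noncomputable def ofRightAdjEval (X : Rep (m + 1) C) (i : Fin (m + 1))
    (hX : ∀ j, i < j → IsZero (X.obj j)) {M : C} (g : M ⟶ X.obj 0) :
    (rightAdjEval (m + 1) C i).obj M ⟶ X where
  -- After i the source has no paths to sum over and the target vanishes by `hX`, so the value 0 is
  -- forced.
  app j := if h : j ≤ i then
    rightProj M (homOfLE h) ≫ g ≫ X.map (homOfLE (Fin.zero_le j)) else 0
  naturality j k α := by
    by_cases h : k ≤ i
    · rw [dif_pos h, dif_pos ((leOfHom α).trans h), reassoc_of% map_rightProj]
      simp only [Category.assoc, ← X.map_comp]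
      rfl
    · exact (hX k (not_le.1 h)).eq_of_tgt _ _

/-- The map `X ⟶ P_i(M)` given by a map from the last entry of `X` to `M`, when `X` vanishes
before `i`. -/
noncomputable def toLeftAdjEval (X : Rep (m + 1) C) (i : Fin (m + 1))
    (hX : ∀ j, j < i → IsZero (X.obj j)) {M : C} (g : X.obj (Fin.last m) ⟶ M) :
    X ⟶ (leftAdjEval (m + 1) C i).obj M where
  app j := if h : i ≤ j then
    X.map (homOfLE (Fin.le_last j)) ≫ g ≫ leftIncl M (homOfLE h) else 0
  naturality j k α := by
    by_cases h : i ≤ j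
    · rw [dif_pos h, dif_pos (h.trans (leOfHom α)), Category.assoc, Category.assoc, leftIncl_map,
        ← X.map_comp_assoc]
      rfl
    · exact (hX j (not_le.1 h)).eq_of_src _ _

/-- At j ≤ i the composite is X_i → X_0 → X_j → X_i, that is, the section `g` followed by X_0 → X_i.
-/
lemma ofRightAdjEval_comp (X : Rep (m + 1) C) (i : Fin (m + 1))
    (hX : ∀ j, i < j → IsZero (X.obj j)) (g : X.obj i ⟶ X.obj 0)
    (hg : g ≫ X.map (homOfLE (Fin.zero_le i)) = 𝟙 _) :
    ofRightAdjEval X i hX g ≫ toRightAdjEval X i = 𝟙 _ := by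
  ext j
  apply rightAdjEval_hom_ext
  intro t
  rw [NatTrans.comp_app, Category.assoc, toRightAdjEval_app_rightProj, NatTrans.id_app,
    Category.id_comp]
  simp only [ofRightAdjEval, dif_pos (leOfHom t), Category.assoc, ← X.map_comp]
  have : homOfLE (Fin.zero_le j) ≫ t = homOfLE (Fin.zero_le i) := rfl
  rw [this, hg, Category.comp_id]
  rfl

lemma ofLeftAdjEval_comp (X : Rep (m + 1) C) (i : Fin (m + 1))
    (hX : ∀ j, j < i → IsZero (X.obj j)) (g : X.obj (Fin.last m) ⟶ X.obj i)
    (hg : X.map (homOfLE (Fin.le_last i)) ≫ g = 𝟙 _) :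
    ofLeftAdjEval X i ≫ toLeftAdjEval X i hX g = 𝟙 _ := by
  ext j
  apply leftAdjEval_hom_ext
  intro t
  rw [NatTrans.comp_app, reassoc_of% leftIncl_ofLeftAdjEval_app, NatTrans.id_app, Category.comp_id]
  simp only [toLeftAdjEval, dif_pos (leOfHom t), ← X.map_comp_assoc]
  have : t ≫ homOfLE (Fin.le_last j) = homOfLE (Fin.le_last i) := rfl
  rw [this, reassoc_of% hg]
  rfl

lemma isZero_kernel_obj_of_mono {X Y : Rep (m + 1) C} (r : X ⟶ Y) (j : Fin (m + 1))
    [Mono (r.app j)] : IsZero ((kernel r).obj j) := by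
  have h : (kernel.ι r).app j ≫ r.app j = 0 := by
    rw [← NatTrans.comp_app, kernel.condition]; rfl
  have h' : (kernel.ι r).app j = 0 := by
    rwa [← cancel_mono (r.app j), zero_comp]
  have : Mono ((kernel.ι r).app j) := inferInstance
  rw [IsZero.iff_id_eq_zero, ← cancel_mono ((kernel.ι r).app j), h', comp_zero, comp_zero]

lemma isZero_of_obj {X : Rep (m + 1) C} (h : ∀ j, IsZero (X.obj j)) : IsZero X := by
  rw [IsZero.iff_id_eq_zero]
  ext j
  exact (h j).eq_of_src _ _

lemma isZero_of_retract {X Y : C} (r : Retract Y X) (h : IsZero X) : IsZero Y := by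
  rw [IsZero.iff_id_eq_zero, ← r.retract, h.eq_zero_of_tgt r.i, zero_comp]

/-- Induction on the length of the support: at the last vertex i where X may be nonzero, I_i(X_i)
splits off, and the complement is a retract of X supported before i. -/
lemma tilting_of_vanishing (k : ℕ) : ∀ X : Rep (m + 1) C, epimorphic (m + 1) C X →
    projReps (m + 1) C X → (∀ j : Fin (m + 1), k ≤ j.val → IsZero (X.obj j)) →
    tiltingSubcategory (m + 1) C X := by
  induction k with
  | zero => exact fun X _ _ h => .zero X (isZero_of_obj fun j => h j (Nat.zero_le _))
  | succ k ih =>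
    intro X hX hX' h
    by_cases hk : k < m + 1
    swap
    · exact ih X hX hX' fun j hj => absurd j.2 (by omega)
    let i : Fin (m + 1) := ⟨k, hk⟩
    have : Projective (X.obj i) := hX' i
    have : Epi (X.map (homOfLE (Fin.zero_le i))) := hX _
    have hi : ∀ j, i < j → IsZero (X.obj j) := fun j hj => h j hj
    -- X_i is projective, so the epimorphism X_0 → X_i has a section.
    have e := ofRightAdjEval_comp X i hi
      (Projective.factorThru (𝟙 _) (X.map (homOfLE (Fin.zero_le i))))
      (Projective.factorThru_comp _ _)
    have R := kernelRetract _ _ e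
    refine addClosure_of_splitting _ _ e (.of _ ⟨i, X.obj i, inferInstance, rfl⟩)
      (ih _ (epimorphic_of_retract _ R hX) (fun j => ?_) fun j hj => ?_)
    · have : Projective (X.obj j) := hX' j
      exact (retractApp _ R j).projective
    · rcases hj.eq_or_lt with hj | hj
      · obtain rfl : i = j := Fin.ext hj
        -- At i itself, the map to I_i(X_i) followed by the projection is the identity, so its
        -- kernel is zero there.
        have e' := toRightAdjEval_app_rightProj X (𝟙 i)
        rw [X.map_id] at e'
        have : Mono ((toRightAdjEval X i).app i) :=
          mono_of_mono_fac e'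
        exact isZero_kernel_obj_of_mono _ _
      · exact isZero_of_retract (retractApp _ R j) (h j hj)

/-- The mirror image: X is supported on the last k vertices, and P_i(X_i) splits off at the first of
them by a retraction of the monomorphism from X_i to the last entry. -/
lemma cotilting_of_vanishing (k : ℕ) : ∀ X : Rep (m + 1) C, monomorphic (m + 1) C X →
    injReps (m + 1) C X → (∀ j : Fin (m + 1), j.val + k < m + 1 → IsZero (X.obj j)) →
    cotiltingSubcategory (m + 1) C X := by
  induction k with
  | zero => exact fun X _ _ h => .zero X (isZero_of_obj fun j => h j j.2)
  | succ k ih =>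
    intro X hX hX' h
    by_cases hk : k < m + 1
    swap
    · exact ih X hX hX' fun j hj => absurd j.2 (by omega)
    -- The hypothesis for k + 1 kills exactly the vertices below m - k, so this is the first vertex
    -- that may carry something.
    let i : Fin (m + 1) := ⟨m - k, by omega⟩
    have : Injective (X.obj i) := hX' i
    have : Mono (X.map (homOfLE (Fin.le_last i))) := hX _
    have hi : ∀ j, j < i → IsZero (X.obj j) := fun j hj => h j (by
      have : j.val < m - k := hj
      omega)
    obtain ⟨g, hg⟩ := Injective.factors (𝟙 _) (X.map (homOfLE (Fin.le_last i)))
    have e := ofLeftAdjEval_comp X i hi g hg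
    have R := kernelRetract _ _ e
    refine addClosure_of_splitting _ _ e (.of _ ⟨i, X.obj i, inferInstance, rfl⟩)
      (ih _ (monomorphic_of_retract _ R hX) (fun j => ?_) fun j hj => ?_)
    · have : Injective (X.obj j) := hX' j
      exact (retractApp _ R j).injective
    · by_cases hji : j.val = m - k
      · obtain rfl : i = j := Fin.ext hji.symm
        have e₁ := leftIncl_ofLeftAdjEval_app X (𝟙 i)
        rw [X.map_id] at e₁
        -- By `hg` the map to P_i(X_i) is at i just the inclusion, which `e₁` makes a split
        -- monomorphism.
        have e₂ : (toLeftAdjEval X i hi g).app i = leftIncl _ (𝟙 i) :=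
          (dif_pos le_rfl).trans (by rw [reassoc_of% hg]; rfl)
        have : Mono ((toLeftAdjEval X i hi g).app i) := by
          rw [e₂]
          exact mono_of_mono_fac e₁
        exact isZero_kernel_obj_of_mono _ _
      · exact isZero_of_retract (retractApp _ R j) (h j (by omega))

theorem tiltingSubcategory_eq :
    tiltingSubcategory (m + 1) C = epimorphic (m + 1) C ⊓ projReps (m + 1) C :=
  le_antisymm (tiltingSubcategory_le _) fun X hX =>
    tilting_of_vanishing (m + 1) X hX.1 hX.2 fun j hj => absurd j.2 (not_lt.2 hj)

theorem cotiltingSubcategory_eq :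
    cotiltingSubcategory (m + 1) C = monomorphic (m + 1) C ⊓ injReps (m + 1) C :=
  le_antisymm (cotiltingSubcategory_le _) fun X hX =>
    cotilting_of_vanishing (m + 1) X hX.1 hX.2 fun j hj => absurd hj (by omega)

end Generation

end AnRep

namespace AnRep

/-! ### Trivial fibrations: lifting and existence of resolutions. -/

section TrivialFibration

open ComposableArrows

variable {A : Type u} [Category.{v} A]

/-- A morphism of representations `p : X ⟶ Y` is a trivial fibration if it is an epimorphism at
every vertex and `X_i ⟶ Y_i ×_{Y_j} X_j` is an epimorphism for all `i ≤ j`. -/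
structure IsTrivialFibration {n : ℕ} {X Y : Rep n A} (p : X ⟶ Y) : Prop where
  epi_app : ∀ i, Epi (p.app i)
  -- Surjectivity onto the fibre product is phrased with generalized elements, up to an epimorphic
  -- refinement of Z, so no pullback has to exist.
  square : ∀ ⦃i j : Fin n⦄ (α : i ⟶ j) ⦃Z : A⦄ (y : Z ⟶ Y.obj i) (x : Z ⟶ X.obj j),
    y ≫ Y.map α = x ≫ p.app j → ∃ (Z' : A) (π : Z' ⟶ Z) (_ : Epi π) (x' : Z' ⟶ X.obj i),
      π ≫ y = x' ≫ p.app i ∧ π ≫ x = x' ≫ X.map α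

lemma square_id {n : ℕ} {X Y : Rep n A} (p : X ⟶ Y) {i : Fin n} (α : i ⟶ i) {Z : A}
    (y : Z ⟶ Y.obj i) (x : Z ⟶ X.obj i) (h : y ≫ Y.map α = x ≫ p.app i) :
    ∃ (Z' : A) (π : Z' ⟶ Z) (_ : Epi π) (x' : Z' ⟶ X.obj i),
      π ≫ y = x' ≫ p.app i ∧ π ≫ x = x' ≫ X.map α := by
  obtain rfl : α = 𝟙 i := Subsingleton.elim _ _
  rw [Y.map_id, Category.comp_id] at h
  exact ⟨Z, 𝟙 Z, inferInstance, x, by rw [Category.id_comp, h], by simp⟩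

/-- An epimorphism onto a projective Z splits, so the refinement can be removed. -/
lemma IsTrivialFibration.exists_of_projective {n : ℕ} {X Y : Rep n A} {p : X ⟶ Y}
    (hp : IsTrivialFibration p) {i j : Fin n} (α : i ⟶ j) {Z : A} [Projective Z]
    (y : Z ⟶ Y.obj i) (x : Z ⟶ X.obj j) (h : y ≫ Y.map α = x ≫ p.app j) :
    ∃ x' : Z ⟶ X.obj i, x' ≫ p.app i = y ∧ x' ≫ X.map α = x := by
  obtain ⟨Z', π, hπ, x', h₁, h₂⟩ := hp.square α y x h
  have e := Projective.factorThru_comp (𝟙 Z) π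
  exact ⟨Projective.factorThru (𝟙 Z) π ≫ x', by rw [Category.assoc, ← h₁, reassoc_of% e],
    by rw [Category.assoc, ← h₂, reassoc_of% e]⟩

lemma IsTrivialFibration.δ₀ {k : ℕ} {X Y : ComposableArrows A (k + 1)} {p : X ⟶ Y}
    (hp : IsTrivialFibration p) :
    IsTrivialFibration (n := k + 1) (δ₀Functor.map p) where
  epi_app i := hp.epi_app i.succ
  square _ _ α _ y x h := hp.square ((Fin.succFunctor (k + 1)).map α) y x h

/-- Representations with projective entries lift along trivial fibrations. -/
theorem IsTrivialFibration.exists_lift {k : ℕ} : ∀ {P X Y : ComposableArrows A k}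
    (_ : ∀ i, Projective (P.obj i)) {p : X ⟶ Y} (_ : IsTrivialFibration (n := k + 1) p)
    (f : P ⟶ Y), ∃ g : P ⟶ X, g ≫ p = f := by
  induction k with
  | zero =>
    intro P X Y hP p hp f
    have := hP 0
    have := hp.epi_app 0
    exact ⟨homMk₀ (Projective.factorThru (f.app 0) (p.app 0)),
      hom_ext₀ (Projective.factorThru_comp (f.app 0) (p.app 0))⟩
  | succ k ih =>
    intro P X Y hP p hp f
    obtain ⟨β, hβ⟩ := ih (P := P.δ₀) (fun i => hP i.succ) hp.δ₀ (δ₀Functor.map f)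
    have := hP 0
    obtain ⟨b, hb⟩ : ∃ b : P.obj 1 ⟶ X.obj 1, b = β.app 0 := ⟨_, rfl⟩
    have hβ₀ : b ≫ p.app 1 = f.app 1 := hb ▸ congrArg (fun t => NatTrans.app t 0) hβ
    -- With the lift known on the tail, the square over 0 → 1 alone supplies the component at 0 and
    -- its compatibility.
    obtain ⟨g, hg, hg'⟩ := hp.exists_of_projective (homOfLE (Fin.zero_le 1)) (f.app 0)
      (P.map (homOfLE (Fin.zero_le 1)) ≫ b) (by rw [Category.assoc, hβ₀, f.naturality])
    subst hb
    exact ⟨homMkSucc g β hg'.symm, hom_ext_succ hg hβ⟩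

variable [Abelian A]

/-- Every representation admits a trivial fibration from a representation with projective
entries. -/
theorem exists_isTrivialFibration [EnoughProjectives A] {k : ℕ} :
    ∀ Y : ComposableArrows A k, ∃ (X : ComposableArrows A k) (p : X ⟶ Y),
      (∀ i, Projective (X.obj i)) ∧ IsTrivialFibration (n := k + 1) p := by
  induction k with
  | zero =>
    intro Y
    refine ⟨mk₀ (Projective.over (Y.obj 0)), homMk₀ (Projective.π (Y.obj 0)), fun i => ?_,
      ⟨fun i => ?_, fun i j α Z y x h => ?_⟩⟩
    · exact Projective.projective_over _
    · obtain rfl : i = 0 := Fin.fin_one_eq_zero i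
      exact Projective.π_epi _
    · obtain rfl : i = 0 := Fin.fin_one_eq_zero i
      obtain rfl : j = 0 := Fin.fin_one_eq_zero j
      exact square_id _ α y x h
  | succ k ih =>
    intro Y
    obtain ⟨X, p, hX, hp⟩ := ih Y.δ₀
    obtain ⟨a, ha⟩ : ∃ a : Y.obj 0 ⟶ Y.obj 1, a = Y.map' 0 1 := ⟨_, rfl⟩
    obtain ⟨b, hb⟩ : ∃ b : X.obj 0 ⟶ Y.obj 1, b = p.app 0 := ⟨_, rfl⟩
    have : Epi b := hb ▸ hp.epi_app 0
    have w : Projective.π (pullback a b) ≫ pullback.snd a b ≫ b =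
      (Projective.π (pullback a b) ≫ pullback.fst a b) ≫ a := by
        rw [Category.assoc, pullback.condition]
    -- The tail is already resolved by X; the new first entry is a projective cover, not necessarily
    -- minimal, of Y_0 ×_{Y_1} X_0, where X_0 sits over Y_1.
    let Q : ComposableArrows A (k + 1) := X.precomp (Projective.π (pullback a b) ≫ pullback.snd a b)
    let q : Q ⟶ Y := homMkSucc (Projective.π (pullback a b) ≫ pullback.fst a b) p (by
      subst ha hb
      exact (Category.assoc _ _ _).trans w)
    have hq : Epi (q.app 0) := epi_comp (Projective.π (pullback a b)) (pullback.fst a b)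
    refine ⟨Q, q, Fin.cases (Projective.projective_over _) hX,
      ⟨Fin.cases hq hp.epi_app, fun i j α Z y x h => ?_⟩⟩
    · induction i using Fin.cases with
      | zero =>
        induction j using Fin.cases with
        | zero => exact square_id q α y x h
        | succ j =>
          obtain ⟨c, hc⟩ : ∃ c : Y.obj 1 ⟶ Y.obj j.succ, c = Y.δ₀.map (homOfLE (Fin.zero_le j)) :=
            ⟨_, rfl⟩
          have hac : a ≫ c = Y.map α := by
            rw [ha, hc]
            exact (Y.map_comp _ _).symm
          have h' : (y ≫ a) ≫ c = x ≫ p.app j := by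
            rw [Category.assoc, hac]
            exact h
          -- The square over 0 → j + 1 is filled in two stages: lift over 1 → j + 1 in the tail to
          -- get `z`, then lift the pair (y, z) from the pullback to its projective cover.
          obtain ⟨Z₁, π₁, _, z, hz, hz'⟩ := hp.square (homOfLE (Fin.zero_le j)) (y ≫ a) x (hc ▸ h')
          have hz₁ : (π₁ ≫ y) ≫ a = z ≫ b :=
            (Category.assoc _ _ _).trans (hz.trans (hb ▸ rfl))
          obtain ⟨Z₂, π₂, _, t, ht⟩ := surjective_up_to_refinements_of_epi
            (Projective.π (pullback a b)) (pullback.lift (π₁ ≫ y) z hz₁)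
          refine ⟨Z₂, π₂ ≫ π₁, inferInstance, t, ?_, ?_⟩
          · have := congrArg (· ≫ pullback.fst a b) ht
            simp only [Category.assoc, pullback.lift_fst] at this
            rw [Category.assoc]
            exact this
          · have := congrArg (· ≫ pullback.snd a b) ht
            simp only [Category.assoc, pullback.lift_snd] at this
            have e : Q.map α = (Projective.π (pullback a b) ≫ pullback.snd a b) ≫
                X.map (homOfLE (Fin.zero_le j)) :=
              Q.map_comp (homOfLE (Fin.zero_le 1) : (0 : Fin (k + 1 + 1)) ⟶ 1)
                (homOfLE (Fin.succ_le_succ_iff.2 (Fin.zero_le j)) : (1 : Fin (k + 1 + 1)) ⟶ j.succ)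
            have e' : π₂ ≫ z ≫ X.map (homOfLE (Fin.zero_le j)) =
                t ≫ (Projective.π (pullback a b) ≫ pullback.snd a b) ≫
                  X.map (homOfLE (Fin.zero_le j)) := by
              rw [← Category.assoc, this]
              simp only [Category.assoc]
            rw [Category.assoc]
            exact (congrArg (π₂ ≫ ·) hz').trans (e'.trans (congrArg (t ≫ ·) e).symm)
      | succ i =>
        induction j using Fin.cases with
        | zero => exact absurd (leOfHom α) (by simp)
        | succ j =>
          exact hp.square (homOfLE (Fin.succ_le_succ_iff.1 (leOfHom α))) y x h

end TrivialFibration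

/-! ### The cokernel functor. -/

section Cokernel

variable {A : Type u} [Category.{v} A] {m : ℕ}

/-- The map from the first entry of a representation to the `i`-th of the other entries. -/
abbrev fromFirst (P : Rep (m + 1) A) (i : Fin m) : P.obj 0 ⟶ P.obj i.succ :=
  P.map (homOfLE (Fin.zero_le _))

/-- The arrow `i + 1 ⟶ j + 1` given by an arrow `i ⟶ j`. -/
abbrev succHom {i j : Fin m} (α : i ⟶ j) : i.succ ⟶ j.succ :=
  homOfLE (Fin.succ_le_succ_iff.2 (leOfHom α))

lemma fromFirst_map (P : Rep (m + 1) A) {i j : Fin m} (α : i ⟶ j) :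
    fromFirst P i ≫ P.map (succHom α) = fromFirst P j :=
  (P.map_comp _ _).symm

lemma fromFirst_app {P Q : Rep (m + 1) A} (f : P ⟶ Q) (i : Fin m) :
    fromFirst P i ≫ f.app i.succ = f.app 0 ≫ fromFirst Q i :=
  f.naturality _

variable [Abelian A]

/-- The representation `coker(P_0 ⟶ P_1) ⟶ ⋯ ⟶ coker(P_0 ⟶ P_m)`. -/
noncomputable def cokernelRep (P : Rep (m + 1) A) : Rep m A where
  obj i := cokernel (fromFirst P i)
  map {i j} α := cokernel.desc _ (P.map (succHom α) ≫ cokernel.π (fromFirst P j))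
    (by rw [← Category.assoc, fromFirst_map, cokernel.condition])
  map_id i := by
    rw [← cancel_epi (cokernel.π _), cokernel.π_desc, Category.comp_id]
    exact (congrArg (· ≫ _) (P.map_id i.succ)).trans (Category.id_comp _)
  map_comp α β := by
    rw [← cancel_epi (cokernel.π _), cokernel.π_desc, cokernel.π_desc_assoc, Category.assoc,
      cokernel.π_desc, ← Category.assoc]
    exact congrArg (· ≫ _) (P.map_comp (succHom α) (succHom β))

/-- The projections onto the entries of the cokernel representation. -/
noncomputable def cokernelProj (P : Rep (m + 1) A) (i : Fin m) :
    P.obj i.succ ⟶ (cokernelRep P).obj i :=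
  cokernel.π (fromFirst P i)

instance (P : Rep (m + 1) A) (i : Fin m) : Epi (cokernelProj P i) :=
  inferInstanceAs (Epi (cokernel.π (fromFirst P i)))

lemma fromFirst_cokernelProj (P : Rep (m + 1) A) (i : Fin m) :
    fromFirst P i ≫ cokernelProj P i = 0 :=
  cokernel.condition _

lemma cokernelProj_map (P : Rep (m + 1) A) {i j : Fin m} (α : i ⟶ j) :
    cokernelProj P i ≫ (cokernelRep P).map α = P.map (succHom α) ≫ cokernelProj P j :=
  cokernel.π_desc _ _ _

/-- Exactness at the middle of P_0 → P_{i+1} → coker, in the generalized-element form that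
`IsTrivialFibration` asks for. -/
lemma cokernelProj_exact (P : Rep (m + 1) A) (i : Fin m) {Z : A} (x : Z ⟶ P.obj i.succ)
    (hx : x ≫ cokernelProj P i = 0) :
    ∃ (Z' : A) (π : Z' ⟶ Z) (_ : Epi π) (u : Z' ⟶ P.obj 0), π ≫ x = u ≫ fromFirst P i :=
  (CokernelCofork.IsColimit.comp_π_eq_zero_iff_up_to_refinements
    (cokernelIsCokernel (fromFirst P i)) x).1 hx

/-- The map out of an entry of the cokernel representation. -/
noncomputable def cokernelEntryDesc (P : Rep (m + 1) A) {i : Fin m} {Z : A}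
    (f : P.obj i.succ ⟶ Z) (h : fromFirst P i ≫ f = 0) : (cokernelRep P).obj i ⟶ Z :=
  cokernel.desc (fromFirst P i) f h

lemma cokernelProj_entryDesc (P : Rep (m + 1) A) {i : Fin m} {Z : A}
    (f : P.obj i.succ ⟶ Z) (h : fromFirst P i ≫ f = 0) :
    cokernelProj P i ≫ cokernelEntryDesc P f h = f :=
  cokernel.π_desc _ _ _

/-- The map out of the cokernel representation given by compatible maps vanishing on the first
entry. -/
noncomputable def cokernelRepDesc (P : Rep (m + 1) A) {Y : Rep m A}
    (f : ∀ i : Fin m, P.obj i.succ ⟶ Y.obj i) (h : ∀ i, fromFirst P i ≫ f i = 0)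
    (hf : ∀ {i j : Fin m} (α : i ⟶ j), P.map (succHom α) ≫ f j = f i ≫ Y.map α) :
    cokernelRep P ⟶ Y where
  app i := cokernelEntryDesc P (f i) (h i)
  naturality i j α := by
    rw [← cancel_epi (cokernelProj P i), reassoc_of% cokernelProj_map, cokernelProj_entryDesc,
      reassoc_of% cokernelProj_entryDesc, hf]

lemma cokernelProj_desc (P : Rep (m + 1) A) {Y : Rep m A}
    (f : ∀ i : Fin m, P.obj i.succ ⟶ Y.obj i) (h : ∀ i, fromFirst P i ≫ f i = 0)
    (hf : ∀ {i j : Fin m} (α : i ⟶ j), P.map (succHom α) ≫ f j = f i ≫ Y.map α) (i : Fin m) :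
    cokernelProj P i ≫ (cokernelRepDesc P f h hf).app i = f i :=
  cokernel.π_desc _ _ _

lemma cokernelRep_hom_ext {P : Rep (m + 1) A} {Y : Rep m A} {f g : cokernelRep P ⟶ Y}
    (h : ∀ i, cokernelProj P i ≫ f.app i = cokernelProj P i ≫ g.app i) : f = g := by
  ext i
  rw [← cancel_epi (cokernelProj P i), h]

/-- The map of cokernel representations induced by a map of representations. -/
noncomputable def cokernelRepMap {P Q : Rep (m + 1) A} (f : P ⟶ Q) :
    cokernelRep P ⟶ cokernelRep Q :=
  cokernelRepDesc P (fun i => f.app i.succ ≫ cokernelProj Q i)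
    (fun i => by
      rw [← Category.assoc, fromFirst_app, Category.assoc, fromFirst_cokernelProj, comp_zero])
    (fun α => by rw [f.naturality_assoc, Category.assoc, cokernelProj_map])

lemma cokernelProj_cokernelRepMap {P Q : Rep (m + 1) A} (f : P ⟶ Q) (i : Fin m) :
    cokernelProj P i ≫ (cokernelRepMap f).app i = f.app i.succ ≫ cokernelProj Q i :=
  cokernelProj_entryDesc _ _ _

/-- The functor `P ↦ (coker(P_0 ⟶ P_1) ⟶ ⋯ ⟶ coker(P_0 ⟶ P_m))`. -/
@[simps]
noncomputable def cokernelFunctor (m : ℕ) (A : Type u) [Category.{v} A] [Abelian A] :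
    Rep (m + 1) A ⥤ Rep m A where
  obj P := cokernelRep P
  map f := cokernelRepMap f
  map_id P := cokernelRep_hom_ext fun i => by
    rw [cokernelProj_cokernelRepMap, NatTrans.id_app, NatTrans.id_app, Category.id_comp,
      Category.comp_id]
  map_comp f g := cokernelRep_hom_ext fun i => by
    rw [cokernelProj_cokernelRepMap, NatTrans.comp_app, NatTrans.comp_app,
      reassoc_of% cokernelProj_cokernelRepMap, cokernelProj_cokernelRepMap, Category.assoc]

instance : (cokernelFunctor m A).Additive where
  map_add {P Q f g} := cokernelRep_hom_ext fun i => by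
    change cokernelProj P i ≫ (cokernelRepMap (f + g)).app i =
      cokernelProj P i ≫ ((cokernelRepMap f).app i + (cokernelRepMap g).app i)
    rw [Preadditive.comp_add, cokernelProj_cokernelRepMap, cokernelProj_cokernelRepMap,
      cokernelProj_cokernelRepMap, NatTrans.app_add, Preadditive.add_comp]

end Cokernel

end AnRep

namespace AnRep

/-! ### Kernel, density and fullness of the cokernel functor. -/

section CokernelFunctorProperties

open ComposableArrows ZeroObject

variable {A : Type u} [Category.{v} A] [Abelian A] {m : ℕ}

/-- Extension of a representation by zero at a new first vertex. -/
noncomputable abbrev extendByZero {k : ℕ} (Y : ComposableArrows A k) : ComposableArrows A (k + 1) :=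
  Y.precomp (0 : (0 : A) ⟶ Y.left)

lemma cokernelFunctor_obj_isZero {Z : Rep (m + 1) A} (hZ : epimorphic (m + 1) A Z) :
    IsZero ((cokernelFunctor m A).obj Z) := by
  rw [IsZero.iff_id_eq_zero]
  refine cokernelRep_hom_ext fun i => ?_
  have : Epi (fromFirst Z i) := hZ _
  have h : cokernelProj Z i = 0 := by
    rw [← cancel_epi (fromFirst Z i), fromFirst_cokernelProj, comp_zero]
  rw [h, zero_comp, zero_comp]

/-- A map from a representation with projective entries which is killed by the cokernel functor
factors through an epimorphic representation with projective entries. -/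
theorem exists_factorization_of_cokernelFunctor_map_eq_zero [EnoughProjectives A]
    {P Q : Rep (m + 1) A} (hP : projReps (m + 1) A P) (f : P ⟶ Q)
    (hf : (cokernelFunctor m A).map f = 0) :
    ∃ (T : Rep (m + 1) A) (_ : projReps (m + 1) A T) (_ : epimorphic (m + 1) A T)
      (a : P ⟶ T) (b : T ⟶ Q), f = a ≫ b := by
  let τ : (Functor.const (Fin (m + 1))).obj (Q.obj 0) ⟶ Q :=
    { app := fun i => Q.map (homOfLE (Fin.zero_le i))
      naturality := fun i j α => by
        rw [← Q.map_comp]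
        exact Category.id_comp _ }
  -- The cokernel of `τ` vanishes at vertex 0, and at later vertices its projection factors through
  -- `cokernelProj`, where `hf` applies; so `f` lands in the image of `τ`.
  have hτ : f ≫ cokernel.π τ = 0 := by
    have hc : ∀ i, Q.map (homOfLE (Fin.zero_le i)) ≫ (cokernel.π τ).app i = 0 := fun i =>
      congrArg (fun t => NatTrans.app t i) (cokernel.condition τ)
    ext i
    induction i using Fin.cases with
    | zero =>
      have h := hc 0
      have e : Q.map (homOfLE (Fin.zero_le (0 : Fin (m + 1)))) = 𝟙 _ := Q.map_id _
      rw [e, Category.id_comp] at h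
      rw [NatTrans.comp_app, h, comp_zero]
      rfl
    | succ i =>
      have h : f.app i.succ ≫ cokernelProj Q i = 0 := by
        have hf' : cokernelRepMap f = 0 := hf
        rw [← cokernelProj_cokernelRepMap, hf']
        exact comp_zero
      rw [NatTrans.comp_app, ← cokernelProj_entryDesc Q _ (hc i.succ), reassoc_of% h, zero_comp]
      rfl
  let S := Abelian.image τ
  -- S is a quotient of a constant representation, whose structure maps are identities.
  have hS : epimorphic (m + 1) A S := fun i j α => by
    have h := (Abelian.factorThruImage τ).naturality α
    have : Epi ((Abelian.factorThruImage τ).app j) := inferInstance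
    have : Epi ((Abelian.factorThruImage τ).app i ≫ S.map α) := by
      rw [← h]
      exact epi_comp (𝟙 _) _
    exact epi_of_epi ((Abelian.factorThruImage τ).app i) _
  obtain ⟨T, p, hT, hp⟩ := exists_isTrivialFibration (k := m) S
  obtain ⟨g, hg⟩ := hp.exists_lift hP (kernel.lift (cokernel.π τ) f hτ)
  refine ⟨T, hT, fun i j α => ?_, g, p ≫ Abelian.image.ι τ, ?_⟩
  · rw [epi_iff_surjective_up_to_refinements]
    intro Z x
    have := hS α
    -- To lift an element of T_j to T_i, lift its image in S_j to S_i first; the fibration square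
    -- then lifts the pair.
    obtain ⟨Z₁, π₁, _, y, hy⟩ := surjective_up_to_refinements_of_epi (S.map α) (x ≫ p.app j)
    obtain ⟨Z₂, π₂, _, t, -, ht⟩ := hp.square α y (π₁ ≫ x) (by rw [Category.assoc, hy])
    exact ⟨Z₂, π₂ ≫ π₁, inferInstance, t, by rw [Category.assoc, ht]⟩
  · rw [← Category.assoc, hg]
    exact (kernel.lift_ι _ _ _).symm

/-- Every representation is the cokernel representation of a representation with projective
entries. -/
theorem cokernelFunctor_dense [EnoughProjectives A] (Y : Rep m A) :
    ∃ P : Rep (m + 1) A, projReps (m + 1) A P ∧ Nonempty ((cokernelFunctor m A).obj P ≅ Y) := by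
  cases m with
  | zero =>
    exact ⟨(Functor.const _).obj 0, fun _ => (inferInstance : Projective (0 : A)),
      ⟨NatIso.ofComponents (fun i => i.elim0) (fun {i} => i.elim0)⟩⟩
  | succ k =>
    obtain ⟨P, p, hP, hp⟩ := exists_isTrivialFibration (extendByZero (k := k) Y)
    refine ⟨P, hP, ?_⟩
    have h0 : ∀ i : Fin (k + 1), fromFirst P i ≫ p.app i.succ = 0 := fun i =>
      (p.naturality _).trans (by
        rw [(isZero_zero A).eq_zero_of_tgt (p.app 0)]
        exact zero_comp)
    let φ : cokernelRep P ⟶ Y := cokernelRepDesc P (Y := Y) (fun i => p.app i.succ) h0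
      (fun α => p.naturality (succHom α))
    have hφ : ∀ i, cokernelProj P i ≫ φ.app i = p.app i.succ := cokernelProj_desc _ _ _ _
    have : ∀ i, IsIso (φ.app i) := fun i => by
      have : Epi (φ.app i) := by
        have : Epi (cokernelProj P i ≫ φ.app i) := by
          rw [hφ]
          exact hp.epi_app i.succ
        exact epi_of_epi (cokernelProj P i) _
      have : Mono (φ.app i) := Preadditive.mono_of_cancel_zero _ fun {Z} g hg => by
        obtain ⟨Z₁, π₁, _, x, hx⟩ := surjective_up_to_refinements_of_epi (cokernelProj P i) g
        have hxp : x ≫ p.app i.succ = 0 := by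
          have e : x ≫ cokernelProj P i ≫ φ.app i = 0 := by
            rw [← reassoc_of% hx, hg, comp_zero]
          exact (congrArg (x ≫ ·) (hφ i)).symm.trans e
        -- Over vertex 0 the base is zero, so the square says that P_0 covers the kernel of P_{i+1}
        -- → Y_i.
        obtain ⟨Z₂, π₂, _, t, -, ht⟩ := hp.square (homOfLE (Fin.zero_le i.succ)) 0 x
          (by rw [zero_comp]; exact hxp.symm)
        rw [← cancel_epi π₁, ← cancel_epi π₂, hx, reassoc_of% ht, fromFirst_cokernelProj]
        simp
      exact isIso_of_mono_of_epi _
    have : IsIso φ := @NatIso.isIso_of_isIso_app _ _ _ _ _ _ φ this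
    let e : cokernelRep P ≅ Y := asIso φ
    exact ⟨e⟩

/-- The map from a representation to the extension by zero of its cokernel representation. -/
noncomputable def toExtendByZero {k : ℕ} (P : Rep (k + 1 + 1) A) {Y : Rep (k + 1) A}
    (φ : cokernelRep P ⟶ Y) : P ⟶ extendByZero (k := k) Y :=
  homMkSucc (F := P) (G := extendByZero (k := k) Y) 0
    { app := fun i => cokernelProj P i ≫ φ.app i
      naturality := fun i j α => by
        have h : P.map (succHom α) ≫ cokernelProj P j ≫ φ.app j =
            (cokernelProj P i ≫ φ.app i) ≫ Y.map α := by
          rw [← reassoc_of% cokernelProj_map, φ.naturality, Category.assoc]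
        exact h }
    (by
      have h : fromFirst P 0 ≫ cokernelProj P 0 ≫ φ.app 0 = 0 := by
        rw [reassoc_of% fromFirst_cokernelProj, zero_comp]
      exact h.trans zero_comp.symm)

lemma toExtendByZero_app_succ {k : ℕ} (P : Rep (k + 1 + 1) A) {Y : Rep (k + 1) A}
    (φ : cokernelRep P ⟶ Y) (i : Fin (k + 1)) :
    (toExtendByZero P φ).app i.succ = cokernelProj P i ≫ φ.app i :=
  rfl

/-- The canonical map from a representation to the extension by zero of its cokernel representation
is a trivial fibration. -/
lemma isTrivialFibration_toExtendByZero {k : ℕ} (P : Rep (k + 1 + 1) A) :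
    IsTrivialFibration (toExtendByZero P (𝟙 (cokernelRep P))) where
  epi_app := by
    refine Fin.cases ?_ fun i => ?_
    · exact ⟨fun _ _ _ => (isZero_zero A).eq_of_src _ _⟩
    · rw [toExtendByZero_app_succ]
      exact epi_comp (cokernelProj P i) (𝟙 _)
  square i j α Z y x h := by
    induction j using Fin.cases with
    | zero =>
      obtain rfl : i = 0 := Fin.le_zero_iff.1 (leOfHom α)
      exact square_id _ α y x h
    | succ j =>
      have hp : (toExtendByZero P (𝟙 (cokernelRep P))).app j.succ = cokernelProj P j :=
        (toExtendByZero_app_succ _ _ _).trans (Category.comp_id _)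
      induction i using Fin.cases with
      | zero =>
        have hx : x ≫ cokernelProj P j = 0 :=
          (congrArg (x ≫ ·) hp).symm.trans (h.symm.trans
            ((congrArg (· ≫ _) ((isZero_zero A).eq_zero_of_tgt y)).trans zero_comp))
        obtain ⟨Z₁, π₁, _, u, hu⟩ := cokernelProj_exact P j x hx
        exact ⟨Z₁, π₁, inferInstance, u, (isZero_zero A).eq_of_tgt _ _, hu⟩
      | succ i =>
        have hp' : (toExtendByZero P (𝟙 (cokernelRep P))).app i.succ = cokernelProj P i :=
          (toExtendByZero_app_succ _ _ _).trans (Category.comp_id _)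
        have β : i ⟶ j := homOfLE (Fin.succ_le_succ_iff.1 (leOfHom α))
        obtain ⟨y', rfl⟩ : ∃ y' : Z ⟶ (cokernelRep P).obj i, y' = y := ⟨y, rfl⟩
        have h' : y' ≫ (cokernelRep P).map β = x ≫ cokernelProj P j :=
          Eq.trans h (congrArg (x ≫ ·) hp)
        obtain ⟨Z₁, π₁, _, t, ht⟩ := surjective_up_to_refinements_of_epi (cokernelProj P i) y'
        -- `t` lifts y but may miss x at j + 1; the error dies in the cokernel, so it comes from
        -- P_0, and adding that element at i + 1 repairs `t` without changing its class.
        obtain ⟨Z₂, π₂, _, u, hu⟩ := cokernelProj_exact P j (π₁ ≫ x - t ≫ P.map (succHom β)) (by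
          rw [Preadditive.sub_comp, Category.assoc, Category.assoc, ← h', reassoc_of% ht,
            cokernelProj_map, sub_self])
        refine ⟨Z₂, π₂ ≫ π₁, inferInstance, π₂ ≫ t + u ≫ fromFirst P i, ?_, ?_⟩
        · refine Eq.trans ?_ (congrArg (_ ≫ ·) hp').symm
          have e : (π₂ ≫ π₁) ≫ y' = (π₂ ≫ t + u ≫ fromFirst P i) ≫ cokernelProj P i := by
            rw [Preadditive.add_comp, Category.assoc, Category.assoc, Category.assoc,
              fromFirst_cokernelProj, comp_zero, add_zero, ht]
          exact e
        · obtain rfl : α = succHom β := Subsingleton.elim _ _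
          rw [Preadditive.add_comp, Category.assoc, Category.assoc, Category.assoc, fromFirst_map,
            ← hu, Preadditive.comp_sub]
          abel

/-- The cokernel functor is full on representations with projective entries. -/
theorem cokernelFunctor_full {P Q : Rep (m + 1) A} (hP : projReps (m + 1) A P)
    (φ : (cokernelFunctor m A).obj P ⟶ (cokernelFunctor m A).obj Q) :
    ∃ f : P ⟶ Q, (cokernelFunctor m A).map f = φ := by
  cases m with
  | zero => exact ⟨0, cokernelRep_hom_ext fun i => i.elim0⟩
  | succ k =>
    obtain ⟨f, hf⟩ := (isTrivialFibration_toExtendByZero Q).exists_lift hP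
      (toExtendByZero (Y := cokernelRep Q) P φ)
    refine ⟨f, cokernelRep_hom_ext fun i => ?_⟩
    have h : f.app i.succ ≫ cokernelProj Q i ≫ 𝟙 _ = cokernelProj P i ≫ φ.app i :=
      congrArg (fun t => NatTrans.app t i.succ) hf
    rw [Category.comp_id] at h
    exact (cokernelProj_cokernelRepMap f i).trans h

/-- The additive quotient of the representations with projective entries. -/
theorem projReps_quotient_equivalence [EnoughProjectives A] :
    ∃ e : AdditiveQuotient (tiltingInProj (m + 1) A) ≌ Rep m A, e.functor.Additive := by
  refine fullSubcategory_quotient_equivalence (tiltingSubcategory (m + 1) A)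
    (projReps (m + 1) A) (cokernelFunctor m A) (fun M N hM _ φ => cokernelFunctor_full hM φ)
    cokernelFunctor_dense (fun Z hZ => ?_) (fun M N hM _ f hf => ?_)
  · exact cokernelFunctor_obj_isZero (tiltingSubcategory_le _ _ hZ).1
  · obtain ⟨T, hT, hT', a, b, e⟩ := exists_factorization_of_cokernelFunctor_map_eq_zero hM f hf
    exact ⟨T, hT, tiltingSubcategory_eq.ge T ⟨hT', hT⟩, a, b, e⟩

end CokernelFunctorProperties

end AnRep

namespace AnRep

/-! ### Passage to the opposite category for injective entries. -/

section Duality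

open Opposite

variable {A : Type u} [Category.{v} A]

/-- Reversing the vertices identifies `A_n` with its opposite. -/
def finOpEquivalence (n : ℕ) : (Fin n)ᵒᵖ ≌ Fin n :=
  (orderDualEquivalence (Fin n)).symm.trans Fin.revOrderIso.equivalence

/-- Representations in the opposite category, with the vertices reversed. -/
def repOpEquivalence (n : ℕ) (A : Type u) [Category.{v} A] : (Rep n A)ᵒᵖ ≌ Rep n Aᵒᵖ :=
  (Functor.opUnopEquiv (Fin n) A).trans (finOpEquivalence n).congrLeft

lemma projReps_repOp {n : ℕ} {X : Rep n A} (hX : injReps n A X) :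
    projReps n Aᵒᵖ ((repOpEquivalence n A).functor.obj (op X)) := fun i =>
  Injective.injective_iff_projective_op.1 (hX i.rev)

lemma injReps_unop {n : ℕ} {Y : Rep n Aᵒᵖ} (hY : projReps n Aᵒᵖ Y) :
    injReps n A ((repOpEquivalence n A).inverse.obj Y).unop := fun i =>
  have : Projective (Y.obj i.rev) := hY i.rev
  (inferInstance : Injective (Y.obj i.rev).unop)

lemma epimorphic_repOp {n : ℕ} {X : Rep n A} (hX : monomorphic n A X) :
    epimorphic n Aᵒᵖ ((repOpEquivalence n A).functor.obj (op X)) := fun _ _ α =>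
  have : Mono (X.map (homOfLE (Fin.rev_le_rev.2 (leOfHom α)))) := hX _
  (inferInstance : Epi (X.map (homOfLE (Fin.rev_le_rev.2 (leOfHom α)))).op)

lemma monomorphic_unop {n : ℕ} {Y : Rep n Aᵒᵖ} (hY : epimorphic n Aᵒᵖ Y) :
    monomorphic n A ((repOpEquivalence n A).inverse.obj Y).unop := fun _ _ α =>
  have : Epi (Y.map (homOfLE (Fin.rev_le_rev.2 (leOfHom α)))) := hY _
  (inferInstance : Mono (Y.map (homOfLE (Fin.rev_le_rev.2 (leOfHom α)))).unop)

variable [Abelian A]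

instance (n : ℕ) : (repOpEquivalence n A).functor.Additive where
  map_add := rfl

instance (n : ℕ) : (repOpEquivalence n A).inverse.Additive :=
  (repOpEquivalence n A).inverse_additive

/-- The dual of the cokernel functor. -/
noncomputable def kernelFunctor (m : ℕ) (A : Type u) [Category.{v} A] [Abelian A] :
    Rep (m + 1) A ⥤ Rep m A :=
  ((repOpEquivalence (m + 1) A).functor ⋙ cokernelFunctor m Aᵒᵖ ⋙
    (repOpEquivalence m A).inverse).unop

instance (m : ℕ) : (kernelFunctor m A).Additive where
  map_add {_ _ f g} := Quiver.Hom.op_inj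
    (((repOpEquivalence (m + 1) A).functor ⋙ cokernelFunctor m Aᵒᵖ ⋙
      (repOpEquivalence m A).inverse).map_add (f := f.op) (g := g.op))

/-- The additive quotient of the representations with injective entries. -/
theorem injReps_quotient_equivalence {m : ℕ} [EnoughInjectives A] :
    ∃ e : AdditiveQuotient (cotiltingInInj (m + 1) A) ≌ Rep m A, e.functor.Additive := by
  let Φ := repOpEquivalence (m + 1) A
  let Ψ := repOpEquivalence m A
  refine fullSubcategory_quotient_equivalence (cotiltingSubcategory (m + 1) A)
    (injReps (m + 1) A) (kernelFunctor m A) (fun M N _ hN φ => ?_) (fun Y => ?_)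
    (fun Z hZ => ?_) (fun M N _ hN f hf => ?_)
  -- Duality exchanges source and target: the target N, with injective entries, becomes the
  -- projective source.
  · obtain ⟨f, hf⟩ := cokernelFunctor_full (projReps_repOp hN) (Ψ.inverse.preimage φ.op)
    refine ⟨(Φ.functor.preimage f).unop, Quiver.Hom.op_inj ?_⟩
    change Ψ.inverse.map ((cokernelFunctor m Aᵒᵖ).map (Φ.functor.map (Φ.functor.preimage f))) = φ.op
    rw [Functor.map_preimage, hf]
    exact Ψ.inverse.map_preimage _
  · obtain ⟨P, hP, ⟨e⟩⟩ := cokernelFunctor_dense (Ψ.functor.obj (op Y))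
    refine ⟨(Φ.inverse.obj P).unop, injReps_unop hP, ⟨Iso.unop (?_ : op Y ≅ _)⟩⟩
    exact Ψ.unitIso.app (op Y) ≪≫ Ψ.inverse.mapIso (e.symm ≪≫
      (cokernelFunctor m Aᵒᵖ).mapIso (Φ.counitIso.app P).symm)
  · have h := cokernelFunctor_obj_isZero (epimorphic_repOp (cotiltingSubcategory_le _ _ hZ).1)
    exact (Ψ.inverse.map_isZero h).unop
  · have h : (cokernelFunctor m Aᵒᵖ).map (Φ.functor.map f.op) = 0 :=
      Ψ.inverse.map_injective ((congrArg Quiver.Hom.op hf).trans (Ψ.inverse.map_zero _ _).symm)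
    obtain ⟨T, hT, hT', a, b, e⟩ := exists_factorization_of_cokernelFunctor_map_eq_zero
      (projReps_repOp hN) (Φ.functor.map f.op) h
    refine ⟨(Φ.inverse.obj T).unop, injReps_unop hT,
      cotiltingSubcategory_eq.ge _ ⟨monomorphic_unop hT', injReps_unop hT⟩,
      -- Arrows are reversed, so the second factor `b` yields the first map M ⟶ Z; the counit
      -- replaces T by the image of its preimage.
      (Φ.functor.preimage ((Φ.counitIso.app T).hom ≫ b)).unop,
      (Φ.functor.preimage (a ≫ (Φ.counitIso.app T).inv)).unop, Quiver.Hom.op_inj ?_⟩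
    apply Φ.functor.map_injective
    rw [e]
    change _ = Φ.functor.map (Φ.functor.preimage _ ≫ Φ.functor.preimage _)
    rw [Functor.map_comp, Functor.map_preimage, Functor.map_preimage, Category.assoc,
      Iso.inv_hom_id_assoc]

end Duality

end AnRep

open AnRep in
theorem mainTheorem7 {A : Type u} [Category.{v} A] [Abelian A] (n : ℕ) (hn : 1 ≤ n) :
    (EnoughProjectives A →
      (∃ e : AdditiveQuotient (tiltingInProj n A) ≌ Rep (n - 1) A, e.functor.Additive) ∧
      tiltingSubcategory n A = epimorphic n A ⊓ projReps n A) ∧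
    (EnoughInjectives A →
      (∃ e : AdditiveQuotient (cotiltingInInj n A) ≌ Rep (n - 1) A, e.functor.Additive) ∧
      cotiltingSubcategory n A = monomorphic n A ⊓ injReps n A) := by
  obtain ⟨m, rfl⟩ : ∃ m, n = m + 1 := ⟨n - 1, by omega⟩
  exact ⟨fun _ => ⟨projReps_quotient_equivalence, tiltingSubcategory_eq⟩,
    fun _ => ⟨injReps_quotient_equivalence, cotiltingSubcategory_eq⟩⟩
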